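/- **Setting.** Fix a function-free first-order signature with set $\mathbf P$ of predicate symbols. MKNF formulae are built from atoms $P(t_1,\dots,t_n)$ by $\lnot$, $\land$, $\exists x$ and the modal operators $\mathbf K$ and $\mathbf{not}$; a formula is first-order if it contains no modal operator, and $\mathrm{pr}(\phi)$ is the set of predicate symbols occurring in $\phi$ (similarly for literals and rules below). Under the standard names assumption the Herbrand universe $\Delta$ is the set of constants; $\mathcal I$ is the set of all Herbrand interpretations, i.e. of all sets of ground atoms. For $I\in\mathcal I$ and $M,N\subseteq\mathcal I$, satisfaction of sentences is defined by: $(I,M,N)\models p$ iff $p\in I$ for a ground atom $p$; the usual clauses for $\lnot,\land$; $(I,M,N)\models\exists x\,\phi$ iff $(I,M,N)\models\phi[c/x]$ for some $c\in\Delta$; $(I,M,N)\models\mathbf K\phi$ iff $(J,M,N)\models\phi$ for all $J\in M$; $(I,M,N)\models\mathbf{not}\,\phi$ iff $(J,M,N)\not\models\phi$ for some $J\in N$. For a set $T$ of sentences write $M\models T$ if $(I,M,M)\models\phi$ for all $\phi\in T$ and $I\in M$. An *MKNF interpretation* is a nonempty $M\subseteq\mathcal I$; it is an *MKNF model* of $T$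 if $M\models T$ and for every $M'\supsetneq M$ there are $I'\in M'$ and $\phi\in T$ with $(I',M',M)\not\models\phi$. A *hybrid knowledge base* $\mathcal K=\langle\mathcal O,\mathcal P\rangle$ consists of a set $\mathcal O$ of axioms $\phi$ of a description logic, each with a translation into a first-order sentence $\zeta(\phi)$ (put $\mathrm{pr}(\phi)=\mathrm{pr}(\zeta(\phi))$), and a set $\mathcal P$ of rules $r$, each with a head literal $H(r)$ and a finite set $B(r)$ of body literals, a literal being a ground atom $p$ or a default literal $\mathrm{not}\,p$. Let $\pi(p)=\mathbf K p$, $\pi(\mathrm{not}\,p)=\mathbf{not}\,p$, $\pi(B)=\{\pi(L)\mid L\in B\}$, $\pi(r)=\bigl(\pi(H(r))\subset\bigwedge\pi(B(r))\bigr)$ and $\pi(\mathcal K)=\{\mathbf K\zeta(\phi)\mid\phi\in\mathcal O\}\cup\{\pi(r)\mid r\in\mathcal P\}$. An MKNF model of $\mathcal K$ is an MKNF model of $\pi(\mathcal K)$. A set $U\subseteq\mathbf P$ is a *splitting set* for $\mathcal K$ if for every $\phi\in\mathcal O$, $\mathrm{pr}(\phi)\cap U\ne\emptyset$ implies $\mathrm{pr}(\phi)\subseteq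 U$, and for every $r\in\mathcal P$, $\mathrm{pr}(H(r))\cap U\neq\emptyset$ implies $\mathrm{pr}(r)\subseteq U$. The *bottom* $b_U(\mathcal K)$ consists of the axioms and rules of $\mathcal K$ all of whose predicate symbols lie in $U$; the *top* $t_U(\mathcal K)=\langle t_U(\mathcal O),t_U(\mathcal P)\rangle$ consists of the remaining axioms and rules. For $X\subseteq\mathcal I$ the *reduct* $e_U(\mathcal K,X)$ has the ontology $t_U(\mathcal O)$ and all rules $r'$ for which some $r\in t_U(\mathcal P)$ satisfies $X\models\pi(\{L\in B(r)\mid\mathrm{pr}(L)\subseteq U\})$, $H(r')=H(r)$ and $B(r')=\{L\in B(r)\mid\mathrm{pr}(L)\subseteq\mathbf P\setminus U\}$. A *splitting sequence* for $\mathcal K$ is a sequence $\langle U_\alpha\rangle_{\alpha<\mu}$ of splitting sets for $\mathcal K$, indexed by the ordinals below an ordinal $\mu$, that is monotone ($U_\alpha\subseteq U_\beta$ for $\alpha\le\beta<\mu$), continuous ($U_\alpha=\bigcup_{\eta<\alpha}U_\eta$ for limit ordinals $\alpha<\mu$) and satisfies $\bigcup_{\alpha<\mu}U_\alpha=\mathbf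 P$. A *solution* to $\mathcal K$ with respect to it is a sequence $\langle X_\alpha\rangle_{\alpha<\mu}$ of MKNF interpretations such that 1. $X_0$ is an MKNF model of $b_{U_0}(\mathcal K)$; 2. for every $\alpha$ with $\alpha+1<\mu$, $X_{\alpha+1}$ is an MKNF model of $e_{U_\alpha}\bigl(b_{U_{\alpha+1}}(\mathcal K),\bigcap_{\eta\le\alpha}X_\eta\bigr)$; 3. $X_\alpha=\mathcal I$ for every limit ordinal $\alpha<\mu$. **Theorem (Splitting Sequence Theorem for Hybrid MKNF Knowledge Bases).** Let $\langle U_\alpha\rangle_{\alpha<\mu}$ be a splitting sequence for a hybrid knowledge base $\mathcal K$, and let $M\subseteq\mathcal I$. Then $M$ is an MKNF model of $\mathcal K$ if and only if $M=\bigcap_{\alpha<\mu}X_\alpha$ for some solution $\langle X_\alpha\rangle_{\alpha<\mu}$ to $\mathcal K$ with respect to $\langle U_\alpha\rangle_{\alpha<\mu}$. -/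

import Mathlib

namespace MKNF

universe u v w x

/-- A function-free first-order signature. By the standard names assumption the set `Const` of
constants is also the Herbrand universe. -/
structure Signature where
  /-- predicate symbols -/
  Pred : Type u
  /-- the arity of a predicate symbol -/
  arity : Pred → ℕ
  /-- constants -/
  Const : Type v

/-- Terms with free variables among `n` variables: the signature has no function symbols. -/
inductive Term (S : Signature.{u, v}) (n : ℕ) : Type v
  | var (i : Fin n) : Term S n
  | const (c : S.Const) : Term S n

/-- The value of a term when its variables are replaced by the constants `e`. -/
def Term.val {S : Signature.{u, v}} {n : ℕ} (e : Fin n → S.Const) : Term S n → S.Const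
  | .var i => e i
  | .const c => c

/-- MKNF formulae with free variables among `n` variables; `ex` binds the last of the `n + 1`
variables of its argument. -/
inductive Formula (S : Signature.{u, v}) : ℕ → Type (max u v)
  | atom {n : ℕ} (P : S.Pred) (t : Fin (S.arity P) → Term S n) : Formula S n
  | neg {n : ℕ} (φ : Formula S n) : Formula S n
  | and {n : ℕ} (φ ψ : Formula S n) : Formula S n
  | ex {n : ℕ} (φ : Formula S (n + 1)) : Formula S n
  | know {n : ℕ} (φ : Formula S n) : Formula S n
  | naf {n : ℕ} (φ : Formula S n) : Formula S n

/-- MKNF sentences: formulae without free variables. -/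
abbrev Sentence (S : Signature.{u, v}) := Formula S 0

/-- The set of predicate symbols occurring in a formula. -/
def Formula.preds {S : Signature.{u, v}} : {n : ℕ} → Formula S n → Set S.Pred
  | _, .atom P _ => {P}
  | _, .neg φ => φ.preds
  | _, .and φ ψ => φ.preds ∪ ψ.preds
  | _, .ex φ => φ.preds
  | _, .know φ => φ.preds
  | _, .naf φ => φ.preds

/-- A formula is first-order if it contains no modal operator. -/
def Formula.IsFirstOrder {S : Signature.{u, v}} : {n : ℕ} → Formula S n → Prop
  | _, .atom _ _ => True
  | _, .neg φ => φ.IsFirstOrder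
  | _, .and φ ψ => φ.IsFirstOrder ∧ ψ.IsFirstOrder
  | _, .ex φ => φ.IsFirstOrder
  | _, .know _ => False
  | _, .naf _ => False

/-- Ground atoms. -/
structure GroundAtom (S : Signature.{u, v}) : Type (max u v) where
  pred : S.Pred
  args : Fin (S.arity pred) → S.Const

/-- A Herbrand interpretation is the set of ground atoms that are true in it. -/
abbrev Interp (S : Signature.{u, v}) := Set (GroundAtom S)

/-- Satisfaction in the MKNF structure `(I, M, N)` of the sentence obtained from a formula by
replacing its free variables by the constants `e`. -/
def Formula.Sat {S : Signature.{u, v}} (M N : Set (Interp S)) :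
    {n : ℕ} → Formula S n → Interp S → (Fin n → S.Const) → Prop
  | _, .atom P t, I, e => (⟨P, fun i => (t i).val e⟩ : GroundAtom S) ∈ I
  | _, .neg φ, I, e => ¬ φ.Sat M N I e
  | _, .and φ ψ, I, e => φ.Sat M N I e ∧ ψ.Sat M N I e
  | _, .ex φ, I, e => ∃ c : S.Const, φ.Sat M N I (Fin.snoc e c)
  | _, .know φ, _, e => ∀ J ∈ M, φ.Sat M N J e
  | _, .naf φ, _, e => ∃ J ∈ N, ¬ φ.Sat M N J e

/-- Satisfaction of a sentence in the MKNF structure `(I, M, N)`. -/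
def Holds {S : Signature.{u, v}} (I : Interp S) (M N : Set (Interp S)) (φ : Sentence S) : Prop :=
  φ.Sat M N I Fin.elim0

/-- `M ⊨ T`, for an arbitrary (possibly empty) set `M` of interpretations. -/
def Entails {S : Signature.{u, v}} (M : Set (Interp S)) (T : Set (Sentence S)) : Prop :=
  ∀ φ ∈ T, ∀ I ∈ M, Holds I M M φ

/-- `M` is an S5 model of `T`. -/
def IsS5Model {S : Signature.{u, v}} (M : Set (Interp S)) (T : Set (Sentence S)) : Prop :=
  M.Nonempty ∧ Entails M T

/-- `M` is an MKNF model of the set of sentences `T`. -/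
def IsMKNFModel {S : Signature.{u, v}} (M : Set (Interp S)) (T : Set (Sentence S)) : Prop :=
  IsS5Model M T ∧ ∀ M' : Set (Interp S), M ⊂ M' → ∃ I' ∈ M', ∃ φ ∈ T, ¬ Holds I' M' M φ

/-- A description logic, given by its axioms and their translation into function-free
first-order sentences. -/
structure DescriptionLogic (S : Signature.{u, v}) where
  Axiom : Type w
  toFO : Axiom → Sentence S
  isFirstOrder_toFO : ∀ a, (toFO a).IsFirstOrder

/-- The predicate symbols of an ontology axiom. -/
def DescriptionLogic.preds {S : Signature.{u, v}} (D : DescriptionLogic.{u, v, w} S)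
    (a : D.Axiom) : Set S.Pred :=
  (D.toFO a).preds

/-- A literal is a ground atom or a default-negated ground atom. -/
inductive Literal (S : Signature.{u, v}) : Type (max u v)
  | pos (p : GroundAtom S) : Literal S
  | dnot (p : GroundAtom S) : Literal S

def Literal.preds {S : Signature.{u, v}} : Literal S → Set S.Pred
  | .pos p => {p.pred}
  | .dnot p => {p.pred}

/-- A rule: its head is a literal, its body a finite set of literals. -/
structure Rule (S : Signature.{u, v}) : Type (max u v) where
  head : Literal S
  body : Finset (Literal S)

/-- The predicate symbols occurring in a rule. -/
def Rule.preds {S : Signature.{u, v}} (r : Rule S) : Set S.Pred :=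
  r.head.preds ∪ ⋃ L ∈ r.body, L.preds

/-- A hybrid knowledge base: an ontology together with a generalised logic program. -/
structure HybridKB {S : Signature.{u, v}} (D : DescriptionLogic.{u, v, w} S) where
  ontology : Set D.Axiom
  program : Set (Rule S)

/-- A ground atom as a sentence. -/
def GroundAtom.toSentence {S : Signature.{u, v}} (p : GroundAtom S) : Sentence S :=
  .atom p.pred fun i => .const (p.args i)

/-- `π(p) = K p` and `π(not p) = not p`. -/
def Literal.toMKNF {S : Signature.{u, v}} : Literal S → Sentence S
  | .pos p => .know p.toSentence
  | .dnot p => .naf p.toSentence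

/-- `π(r)`: the material implication `π(H) ⊂ π(L₁) ∧ … ∧ π(L_k)`, written out as
`¬ (π(L₁) ∧ (… ∧ (π(L_k) ∧ ¬ π(H))))` for some enumeration `L₁, …, L_k` of the body. -/
noncomputable def Rule.toMKNF {S : Signature.{u, v}} (r : Rule S) : Sentence S :=
  .neg (r.body.toList.foldr (fun L ψ => .and L.toMKNF ψ) (.neg r.head.toMKNF))

/-- `π(K)`. -/
def HybridKB.toMKNF {S : Signature.{u, v}} {D : DescriptionLogic.{u, v, w} S}
    (K : HybridKB D) : Set (Sentence S) :=
  (fun a => Formula.know (D.toFO a)) '' K.ontology ∪ Rule.toMKNF '' K.program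

/-- `M` is an MKNF model of the hybrid knowledge base `K`. -/
def HybridKB.IsModel {S : Signature.{u, v}} {D : DescriptionLogic.{u, v, w} S}
    (K : HybridKB D) (M : Set (Interp S)) : Prop :=
  IsMKNFModel M K.toMKNF

/-- `U` is a splitting set for `K`. -/
def HybridKB.IsSplittingSet {S : Signature.{u, v}} {D : DescriptionLogic.{u, v, w} S}
    (K : HybridKB D) (U : Set S.Pred) : Prop :=
  (∀ a ∈ K.ontology, (D.preds a ∩ U).Nonempty → D.preds a ⊆ U) ∧
    ∀ r ∈ K.program, (r.head.preds ∩ U).Nonempty → r.preds ⊆ U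

/-- The bottom `b_U(K)` of `K` relative to `U`. -/
def HybridKB.bottom {S : Signature.{u, v}} {D : DescriptionLogic.{u, v, w} S}
    (K : HybridKB D) (U : Set S.Pred) : HybridKB D where
  ontology := {a ∈ K.ontology | D.preds a ⊆ U}
  program := {r ∈ K.program | r.preds ⊆ U}

/-- The top `t_U(K)` of `K` relative to `U`. -/
def HybridKB.top {S : Signature.{u, v}} {D : DescriptionLogic.{u, v, w} S}
    (K : HybridKB D) (U : Set S.Pred) : HybridKB D where
  ontology := K.ontology \ (K.bottom U).ontology
  program := K.program \ (K.bottom U).program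

/-- The splitting set reduct `e_U(K, X)`. -/
def HybridKB.reduct {S : Signature.{u, v}} {D : DescriptionLogic.{u, v, w} S}
    (K : HybridKB D) (U : Set S.Pred) (X : Set (Interp S)) : HybridKB D where
  ontology := (K.top U).ontology
  program := {r' | ∃ r ∈ (K.top U).program,
    Entails X (Literal.toMKNF '' {L | L ∈ r.body ∧ L.preds ⊆ U}) ∧
    r'.head = r.head ∧
    {L | L ∈ r'.body} = {L | L ∈ r.body ∧ L.preds ⊆ Uᶜ}}

/-- `⟨U α⟩_{α < μ}` is a splitting sequence for `K`: a monotone, continuous sequence of splitting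
sets that covers all predicate symbols. Only the values of `U` below `μ` matter. -/
structure HybridKB.IsSplittingSequence {S : Signature.{u, v}} {D : DescriptionLogic.{u, v, w} S}
    (K : HybridKB D) (μ : Ordinal.{x}) (U : Ordinal.{x} → Set S.Pred) : Prop where
  splitting : ∀ α < μ, K.IsSplittingSet (U α)
  monotone : ∀ α β, α ≤ β → β < μ → U α ⊆ U β
  continuous : ∀ α < μ, Order.IsSuccLimit α → U α = ⋃ η < α, U η
  cover : ⋃ α < μ, U α = Set.univ

/-- `⟨X α⟩_{α < μ}` is a solution to `K` with respect to `⟨U α⟩_{α < μ}`. Only the values of `X`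
and `U` below `μ` matter. -/
structure HybridKB.IsSolution {S : Signature.{u, v}} {D : DescriptionLogic.{u, v, w} S}
    (K : HybridKB D) (μ : Ordinal.{x}) (U : Ordinal.{x} → Set S.Pred)
    (X : Ordinal.{x} → Set (Interp S)) : Prop where
  nonempty : ∀ α < μ, (X α).Nonempty
  zero : 0 < μ → (K.bottom (U 0)).IsModel (X 0)
  succ : ∀ α, α + 1 < μ →
    ((K.bottom (U (α + 1))).reduct (U α) (⋂ η ≤ α, X η)).IsModel (X (α + 1))
  limit : ∀ α < μ, Order.IsSuccLimit α → X α = Set.univ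

end MKNF

/-! Give each predicate symbol as rank the first index at which it enters the sequence; a layer
consists of the symbols of one rank. Splitting then means that every axiom lives on a single layer
and that no body literal outranks the head of its rule. In these terms a solution is a family whose
member `X α` is maximal for the conditions of layer `α` alone (`LayerSat`), with lower body literals
evaluated in the intersection of the earlier members. Limit layers are empty, which is why the
member there is the set of all interpretations.

Maximality makes `X α` depend on layer `α` only, so the intersection of all `X α` is a product with
these factors (`saturate_iInter`), and a literal sees only the projection to its own layer
(`Literal.sat_congr`). For a solution, any larger set satisfying the knowledge base relative to the
product is confined to each factor, by induction on rank (`IsLayerSolution.isStable`). Conversely, a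
model is the product of its projections, by maximality (`iInter_saturate_eq`), and a projection that
could be enlarged would allow the model itself to be enlarged (`isLayerSolution_saturate`). -/

namespace MKNF

universe u v w x y

/-! ### Satisfaction of literals, rules and knowledge bases -/

section Semantics

variable {S : Signature.{u, v}}

/-- The predicate symbol of a literal. -/
def Literal.pred : Literal S → S.Pred
  | .pos p => p.pred
  | .dnot p => p.pred

/-- Satisfaction of `π(L)` in `(I, M, N)`, which does not depend on `I`. -/
def Literal.Sat (M N : Set (Interp S)) : Literal S → Prop
  | .pos p => ∀ J ∈ M, p ∈ J
  | .dnot p => ∃ J ∈ N, p ∉ J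

theorem Literal.preds_eq (L : Literal S) : L.preds = {L.pred} := by
  cases L <;> rfl

theorem Literal.holds_toMKNF (L : Literal S) (I : Interp S) (M N : Set (Interp S)) :
    Holds I M N L.toMKNF ↔ L.Sat M N := by
  cases L <;> rfl

/-- Only `K`-literals see the first argument, and enlarging it can only falsify them. Hence a rule
body true in a larger set is true in a smaller one. -/
theorem Literal.Sat.anti {M M' N : Set (Interp S)} (h : M ⊆ M') {L : Literal S}
    (hL : L.Sat M' N) : L.Sat M N := by
  cases L with
  | pos p => exact fun J hJ => hL J (h hJ)
  | dnot p => exact hL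

/-- Satisfaction of a rule in `(I, M, N)`, which does not depend on `I`. -/
def Rule.Sat (M N : Set (Interp S)) (r : Rule S) : Prop :=
  (∀ L ∈ r.body, L.Sat M N) → r.head.Sat M N

theorem Rule.holds_toMKNF (r : Rule S) (I : Interp S) (M N : Set (Interp S)) :
    Holds I M N r.toMKNF ↔ r.Sat M N := by
  have key : ∀ l : List (Literal S),
      Holds I M N (l.foldr (fun L ψ => .and L.toMKNF ψ) (.neg r.head.toMKNF)) ↔
        (∀ L ∈ l, L.Sat M N) ∧ ¬ r.head.Sat M N := by
    intro l
    induction l with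
    | nil =>
      simp only [List.foldr_nil, List.not_mem_nil, false_implies, implies_true, true_and]
      exact not_congr (r.head.holds_toMKNF I M N)
    | cons L l ih =>
      simp only [List.foldr_cons, List.forall_mem_cons, and_assoc]
      exact and_congr (L.holds_toMKNF I M N) ih
  refine (not_congr (key r.body.toList)).trans ?_
  simp only [Finset.mem_toList, Rule.Sat]
  tauto

/-- Satisfaction of a first-order sentence in a Herbrand interpretation. -/
def Models (I : Interp S) (φ : Sentence S) : Prop := Holds I ∅ ∅ φ

theorem Formula.IsFirstOrder.sat_congr {n : ℕ} {φ : Formula S n} (hφ : φ.IsFirstOrder)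
    {M N M' N' : Set (Interp S)} {I I' : Interp S}
    (h : ∀ p : GroundAtom S, p.pred ∈ φ.preds → (p ∈ I ↔ p ∈ I')) (e : Fin n → S.Const) :
    φ.Sat M N I e ↔ φ.Sat M' N' I' e := by
  induction φ with
  | atom P t => exact h _ rfl
  | neg φ ih => exact not_congr (ih hφ h e)
  | and φ ψ ih₁ ih₂ =>
    exact and_congr (ih₁ hφ.1 (fun p hp => h p (Or.inl hp)) e)
      (ih₂ hφ.2 (fun p hp => h p (Or.inr hp)) e)
  | ex φ ih => exact exists_congr fun c => ih hφ h _
  | know φ => exact hφ.elim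
  | naf φ => exact hφ.elim

/-- With no logical constants among the formulae, every axiom contains an atom and so can be
assigned to a layer. -/
theorem Formula.preds_nonempty {n : ℕ} (φ : Formula S n) : φ.preds.Nonempty := by
  induction φ with
  | atom P t => exact ⟨P, rfl⟩
  | and φ ψ ih₁ ih₂ => exact ih₁.mono Set.subset_union_left
  | neg φ ih => exact ih
  | ex φ ih => exact ih
  | know φ ih => exact ih
  | naf φ ih => exact ih

variable {D : DescriptionLogic.{u, v, w} S}

theorem DescriptionLogic.models_congr (a : D.Axiom) {I I' : Interp S}
    (h : ∀ p : GroundAtom S, p.pred ∈ D.preds a → (p ∈ I ↔ p ∈ I')) :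
    Models I (D.toFO a) ↔ Models I' (D.toFO a) :=
  (D.isFirstOrder_toFO a).sat_congr h _

theorem DescriptionLogic.holds_know (a : D.Axiom) (I : Interp S) (M N : Set (Interp S)) :
    Holds I M N (.know (D.toFO a)) ↔ ∀ J ∈ M, Models J (D.toFO a) :=
  forall₂_congr fun _ _ => (D.isFirstOrder_toFO a).sat_congr (fun _ _ => Iff.rfl) _

/-- Satisfaction of `π(K)` in `(I, M, N)`, which does not depend on `I`. -/
def HybridKB.Sat (M N : Set (Interp S)) (K : HybridKB D) : Prop :=
  (∀ a ∈ K.ontology, ∀ J ∈ M, Models J (D.toFO a)) ∧ ∀ r ∈ K.program, r.Sat M N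

theorem HybridKB.holds_toMKNF (K : HybridKB D) (I : Interp S) (M N : Set (Interp S)) :
    (∀ φ ∈ K.toMKNF, Holds I M N φ) ↔ K.Sat M N := by
  simp only [HybridKB.toMKNF, Set.mem_union, or_imp, forall_and, Set.forall_mem_image,
    DescriptionLogic.holds_know, Rule.holds_toMKNF, HybridKB.Sat]

/-- `M` is a maximal solution of `T M' M` in the first argument: the shape of the definition of
an MKNF model. -/
def IsStable (T : Set (Interp S) → Set (Interp S) → Prop) (M : Set (Interp S)) : Prop :=
  M.Nonempty ∧ T M M ∧ ∀ M', M ⊆ M' → T M' M → M' ⊆ M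

/-- The sentences of `π(K)` do not depend on the current interpretation, so over a nonempty `M'` the
choice of `I'` is immaterial. -/
theorem HybridKB.isModel_iff (K : HybridKB D) (M : Set (Interp S)) :
    K.IsModel M ↔ IsStable (fun M' N => K.Sat M' N) M := by
  have hex : ∀ M' : Set (Interp S), M'.Nonempty →
      ((∃ I' ∈ M', ∃ φ ∈ K.toMKNF, ¬ Holds I' M' M φ) ↔ ¬ K.Sat M' M) := by
    rintro M' ⟨I, hI⟩
    constructor
    · rintro ⟨I', -, φ, hφ, h⟩ hs
      exact h ((K.holds_toMKNF I' M' M).2 hs φ hφ)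
    · intro h
      rw [← K.holds_toMKNF I M' M] at h
      push Not at h
      exact ⟨I, hI, h⟩
  constructor
  · rintro ⟨⟨⟨I, hI⟩, hM⟩, hmax⟩
    refine ⟨⟨I, hI⟩, (K.holds_toMKNF I M M).1 fun φ hφ => hM φ hφ I hI, fun M' hMM' hs => ?_⟩
    by_contra hn
    exact (hex M' ⟨I, hMM' hI⟩).1 (hmax M' ⟨hMM', hn⟩) hs
  · rintro ⟨hne, hM, hmax⟩
    refine ⟨⟨hne, fun φ hφ I _ => (K.holds_toMKNF I M M).2 hM φ hφ⟩, fun M' hMM' => ?_⟩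
    exact (hex M' (hne.mono hMM'.1)).2 fun hs => hMM'.2 (hmax M' hMM'.1 hs)

end Semantics

/-! ### Projection of sets of interpretations to a set of predicate symbols -/

section Saturation

variable {S : Signature.{u, v}}

/-- The interpretations that agree on the predicate symbols in `V` with a member of `M`. -/
def saturate (V : Set S.Pred) (M : Set (Interp S)) : Set (Interp S) :=
  {I | ∃ J ∈ M, ∀ p : GroundAtom S, p.pred ∈ V → (p ∈ I ↔ p ∈ J)}

theorem subset_saturate (V : Set S.Pred) (M : Set (Interp S)) : M ⊆ saturate V M :=
  fun I hI => ⟨I, hI, fun _ _ => Iff.rfl⟩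

theorem saturate_mono (V : Set S.Pred) {M N : Set (Interp S)} (h : M ⊆ N) :
    saturate V M ⊆ saturate V N :=
  fun _ ⟨J, hJ, hIJ⟩ => ⟨J, h hJ, hIJ⟩

theorem saturate_saturate (V : Set S.Pred) (M : Set (Interp S)) :
    saturate V (saturate V M) ⊆ saturate V M := by
  rintro I ⟨J, ⟨J', hJ', h'⟩, h⟩
  exact ⟨J', hJ', fun p hp => (h p hp).trans (h' p hp)⟩

/-- Both kinds of literal ask only whether `p` holds throughout a set, which the projection to `V`
already decides. -/
theorem Literal.sat_congr {V : Set S.Pred} {L : Literal S} (hL : L.pred ∈ V)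
    {M M' N N' : Set (Interp S)} (hM : saturate V M = saturate V M')
    (hN : saturate V N = saturate V N') : L.Sat M N ↔ L.Sat M' N' := by
  have key : ∀ {A B : Set (Interp S)}, saturate V A = saturate V B →
      ∀ p : GroundAtom S, p.pred ∈ V → (∀ J ∈ A, p ∈ J) → ∀ J ∈ B, p ∈ J := by
    intro A B h p hp hA J hJ
    obtain ⟨J', hJ', hJJ'⟩ := h.symm.subset (subset_saturate V B hJ)
    exact (hJJ' p hp).2 (hA J' hJ')
  cases L with
  | pos p => exact ⟨key hM p hL, key hM.symm p hL⟩
  | dnot p =>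
    have := (⟨key hN p hL, key hN.symm p hL⟩ : (∀ J ∈ N, p ∈ J) ↔ ∀ J ∈ N', p ∈ J)
    simpa [Literal.Sat] using not_congr this

theorem DescriptionLogic.models_of_saturate {D : DescriptionLogic.{u, v, w} S} {a : D.Axiom}
    {V : Set S.Pred} (ha : D.preds a ⊆ V) {M : Set (Interp S)}
    (h : ∀ J ∈ M, Models J (D.toFO a)) : ∀ J ∈ saturate V M, Models J (D.toFO a) := by
  rintro J ⟨J', hJ', hJJ'⟩
  exact (D.models_congr a fun p hp => hJJ' p (ha hp)).2 (h J' hJ')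

end Saturation

/-! ### Stratified knowledge bases and layerwise solutions -/

section Layers

variable {S : Signature.{u, v}} {D : DescriptionLogic.{u, v, w} S} {ι : Type y}

/-- The predicate symbols of rank `i`. -/
def layer (rk : S.Pred → ι) (i : ι) : Set S.Pred := {P | rk P = i}

/-- A family of nonempty sets of interpretations, the one with index `i` determined by the
predicate symbols of rank `i`, is a product: the intersection of a subfamily has the members of
the subfamily as its projections. -/
theorem saturate_iInter (rk : S.Pred → ι) (q : ι → Prop) (X : ι → Set (Interp S))
    (hne : ∀ i, q i → (X i).Nonempty)
    (hsat : ∀ i, q i → saturate (layer rk i) (X i) ⊆ X i) {i : ι} (hi : q i) :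
    saturate (layer rk i) (⋂ j, ⋂ (_ : q j), X j) = X i := by
  classical
  refine subset_antisymm ((saturate_mono _ (Set.iInter₂_subset i hi)).trans (hsat i hi)) ?_
  intro J hJ
  have hch : ∀ j, ∃ I : Interp S, (q j → I ∈ X j) ∧ (j = i → I = J) := by
    intro j
    by_cases hji : j = i
    · exact ⟨J, fun _ => hji ▸ hJ, fun _ => rfl⟩
    · by_cases hj : q j
      · obtain ⟨I, hI⟩ := hne j hj
        exact ⟨I, fun _ => hI, fun h => (hji h).elim⟩
      · exact ⟨∅, fun h => (hj h).elim, fun h => (hji h).elim⟩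
  choose I hI hIJ using hch
  -- Glue: each atom is decided by the interpretation chosen for its own rank, and the choice at
  -- rank `i` is `J`.
  refine ⟨{p | p ∈ I (rk p.pred)}, ?_, fun p hp => ?_⟩
  · refine Set.mem_iInter₂.2 fun j hj => hsat j hj ⟨I j, hI j hj, fun p hp => ?_⟩
    have : rk p.pred = j := hp
    simp [this]
  · have : rk p.pred = i := hp
    simp [this, hIJ i rfl]

theorem nonempty_iInter (rk : S.Pred → ι) (q : ι → Prop) (X : ι → Set (Interp S))
    (hne : ∀ i, q i → (X i).Nonempty)
    (hsat : ∀ i, q i → saturate (layer rk i) (X i) ⊆ X i) :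
    (⋂ j, ⋂ (_ : q j), X j).Nonempty := by
  by_cases h : ∃ i, q i
  · obtain ⟨i, hi⟩ := h
    have hX := hne i hi
    rw [← saturate_iInter rk q X hne hsat hi] at hX
    obtain ⟨_, J, hJ, -⟩ := hX
    exact ⟨J, hJ⟩
  · push Not at h
    exact ⟨∅, Set.mem_iInter₂.2 fun i hi => (h i hi).elim⟩

variable [LinearOrder ι]

/-- `K` is stratified by `rk`: axioms live on a single layer, and the bodies of rules do not
exceed the rank of the head. -/
structure HybridKB.IsStratified (K : HybridKB D) (rk : S.Pred → ι) : Prop where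
  ontology : ∀ a ∈ K.ontology, ∃ P, D.preds a ⊆ layer rk (rk P)
  program : ∀ r ∈ K.program, ∀ L ∈ r.body, rk L.pred ≤ rk r.head.pred

/-- Satisfaction of the part of `K` on layer `i` in `(M, N)`, where the body literals of smaller
rank are evaluated in `Z`. -/
def HybridKB.LayerSat (K : HybridKB D) (rk : S.Pred → ι) (i : ι) (Z M N : Set (Interp S)) :
    Prop :=
  (∀ a ∈ K.ontology, D.preds a ⊆ layer rk i → ∀ J ∈ M, Models J (D.toFO a)) ∧
    ∀ r ∈ K.program, rk r.head.pred = i →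
      (∀ L ∈ r.body, rk L.pred < i → Z.Nonempty → L.Sat Z Z) →
      (∀ L ∈ r.body, rk L.pred = i → L.Sat M N) → r.head.Sat M N

theorem HybridKB.LayerSat.saturate_left {K : HybridKB D} {rk : S.Pred → ι} {i : ι}
    {Z M N : Set (Interp S)} (h : K.LayerSat rk i Z M N) :
    K.LayerSat rk i Z (saturate (layer rk i) M) N := by
  have hM : saturate (layer rk i) (saturate (layer rk i) M) = saturate (layer rk i) M :=
    subset_antisymm (saturate_saturate _ _) (subset_saturate _ _)
  refine ⟨fun a ha hal => DescriptionLogic.models_of_saturate hal (h.1 a ha hal), ?_⟩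
  intro r hr hri hZ hb
  exact (Literal.sat_congr hri hM rfl).2
    (h.2 r hr hri hZ fun L hL hLi => (Literal.sat_congr hLi hM rfl).1 (hb L hL hLi))

/-- The layer conditions survive saturation, so maximality leaves no room for a proper one. -/
theorem HybridKB.saturate_subset_of_isStable {K : HybridKB D} {rk : S.Pred → ι} {i : ι}
    {Z X : Set (Interp S)} (h : IsStable (K.LayerSat rk i Z) X) :
    saturate (layer rk i) X ⊆ X :=
  h.2.2 _ (subset_saturate _ _) h.2.1.saturate_left

/-- The sets `X i`, for `i` with `m i`, solve `K` layer by layer. -/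
def HybridKB.IsLayerSolution (K : HybridKB D) (rk : S.Pred → ι) (m : ι → Prop)
    (X : ι → Set (Interp S)) : Prop :=
  ∀ i, m i → IsStable (K.LayerSat rk i (⋂ j, ⋂ (_ : j < i), X j)) (X i)

variable {K : HybridKB D} {rk : S.Pred → ι} {m : ι → Prop}

theorem HybridKB.IsLayerSolution.isStable [WellFoundedLT ι] (hK : K.IsStratified rk)
    (hm : ∀ P, m (rk P)) (hml : ∀ i j, j < i → m i → m j) {X : ι → Set (Interp S)}
    (h : K.IsLayerSolution rk m X) :
    IsStable (fun M' N => K.Sat M' N) (⋂ i, ⋂ (_ : m i), X i) := by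
  have hne : ∀ i, m i → (X i).Nonempty := fun i hi => (h i hi).1
  have hsat : ∀ i, m i → saturate (layer rk i) (X i) ⊆ X i :=
    fun i hi => saturate_subset_of_isStable (h i hi)
  have hX : ∀ i, m i → saturate (layer rk i) (X i) = X i :=
    fun i hi => subset_antisymm (hsat i hi) (subset_saturate _ _)
  set M : Set (Interp S) := ⋂ i, ⋂ (_ : m i), X i
  have hMX : ∀ i, m i → saturate (layer rk i) M = X i :=
    fun i hi => saturate_iInter rk m X hne hsat hi
  have hZ : ∀ i, m i → ∀ j, j < i →
      saturate (layer rk j) (⋂ k, ⋂ (_ : k < i), X k) = X j := fun i hi j hj =>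
    saturate_iInter rk (· < i) X (fun k hk => hne k (hml i k hk hi))
      (fun k hk => hsat k (hml i k hk hi)) hj
  have hlow : ∀ i, m i → ∀ L : Literal S, rk L.pred < i →
      (L.Sat (⋂ k, ⋂ (_ : k < i), X k) (⋂ k, ⋂ (_ : k < i), X k) ↔ L.Sat M M) := by
    intro i hi L hL
    have := (hZ i hi _ hL).trans (hMX _ (hm L.pred)).symm
    exact Literal.sat_congr (V := layer rk (rk L.pred)) rfl this this
  have hMne : M.Nonempty := nonempty_iInter rk m X hne hsat
  refine ⟨hMne, ⟨?_, ?_⟩, ?_⟩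
  · intro a ha J hJ
    obtain ⟨P, hP⟩ := hK.ontology a ha
    exact (h _ (hm P)).2.1.1 a ha hP J (Set.mem_iInter₂.1 hJ _ (hm P))
  · intro r hr hb
    have hi := hm r.head.pred
    have e := (hMX _ hi).trans (hX _ hi).symm
    refine (Literal.sat_congr (V := layer rk _) rfl e e).2
      ((h _ hi).2.1.2 r hr rfl (fun L hL hLi _ => (hlow _ hi L hLi).2 (hb L hL)) ?_)
    exact fun L hL hLi => (Literal.sat_congr (V := layer rk _) hLi e e).1 (hb L hL)
  · intro M' hMM' hs
    suffices H : ∀ i, m i → M' ⊆ X i from Set.subset_iInter₂ H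
    intro i
    induction i using WellFoundedLT.induction with
    | ind i ih =>
    intro hi
    refine (subset_saturate (layer rk i) M').trans ((h i hi).2.2 _ ?_ ?_)
    · rw [← hMX i hi]
      exact saturate_mono _ hMM'
    · refine HybridKB.LayerSat.saturate_left ⟨fun a ha _ => hs.1 a ha, ?_⟩
      -- Lower positive body literals pass from the intersection of the earlier factors to `M'`,
      -- which the induction hypothesis places inside it; negative ones are evaluated in `M`, which
      -- has the same lower projections.
      intro r hr hri hbZ hbi
      have eN : saturate (layer rk i) M = saturate (layer rk i) (X i) :=
        (hMX _ hi).trans (hX _ hi).symm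
      refine (Literal.sat_congr hri rfl eN).1 (hs.2 r hr fun L hL => ?_)
      rcases lt_or_eq_of_le (hri ▸ hK.program r hr L hL) with hlt | heq
      · have hZsub : M' ⊆ ⋂ k, ⋂ (_ : k < i), X k :=
          Set.subset_iInter₂ fun k hk => ih k hk (hml i k hk hi)
        have hLZ := hbZ L hL hlt ((hMne.mono hMM').mono hZsub)
        refine Literal.Sat.anti hZsub ?_
        exact (Literal.sat_congr (V := layer rk (rk L.pred)) rfl rfl
          ((hZ i hi _ hlt).trans (hMX _ (hm L.pred)).symm)).1 hLZ
      · exact (Literal.sat_congr (V := layer rk i) heq rfl eN).2 (hbi L hL heq)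

/-- The product of the projections of `M` contains `M` and still satisfies `K` relative to `M`:
bodies true in it are true in `M`, and heads cannot tell the two apart. -/
theorem HybridKB.iInter_saturate_eq (hK : K.IsStratified rk)
    (hm : ∀ P, m (rk P)) {M : Set (Interp S)} (h : IsStable (fun M' N => K.Sat M' N) M) :
    ⋂ i, ⋂ (_ : m i), saturate (layer rk i) M = M := by
  have e : ∀ i, m i → saturate (layer rk i) (⋂ i, ⋂ (_ : m i), saturate (layer rk i) M) =
      saturate (layer rk i) M := fun i hi =>
    saturate_iInter rk m (fun i => saturate (layer rk i) M)
      (fun i _ => h.1.mono (subset_saturate _ _)) (fun i _ => saturate_saturate _ _) hi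
  have hsub : M ⊆ ⋂ i, ⋂ (_ : m i), saturate (layer rk i) M :=
    Set.subset_iInter₂ fun i _ => subset_saturate _ _
  refine subset_antisymm (h.2.2 _ hsub ⟨?_, ?_⟩) hsub
  · intro a ha J hJ
    obtain ⟨P, hP⟩ := hK.ontology a ha
    exact DescriptionLogic.models_of_saturate hP (h.2.1.1 a ha) J
      (Set.mem_iInter₂.1 hJ _ (hm P))
  · intro r hr hb
    exact (Literal.sat_congr (V := layer rk (rk r.head.pred)) rfl (e _ (hm _)) rfl).2
      (h.2.1.2 r hr fun L hL => (hb L hL).anti hsub)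

theorem HybridKB.isLayerSolution_saturate (hK : K.IsStratified rk)
    (hm : ∀ P, m (rk P)) {M : Set (Interp S)} (h : IsStable (fun M' N => K.Sat M' N) M) :
    K.IsLayerSolution rk m fun i => saturate (layer rk i) M := by
  classical
  intro i hi
  have hss : ∀ i, saturate (layer rk i) (saturate (layer rk i) M) = saturate (layer rk i) M :=
    fun i => subset_antisymm (saturate_saturate _ _) (subset_saturate _ _)
  have hZne : (⋂ j, ⋂ (_ : j < i), saturate (layer rk j) M).Nonempty :=
    h.1.mono (Set.subset_iInter₂ fun j _ => subset_saturate _ _)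
  have hlow : ∀ L : Literal S, rk L.pred < i →
      (L.Sat (⋂ j, ⋂ (_ : j < i), saturate (layer rk j) M)
        (⋂ j, ⋂ (_ : j < i), saturate (layer rk j) M) ↔ L.Sat M M) := by
    intro L hL
    have := saturate_iInter rk (· < i) (fun i => saturate (layer rk i) M)
      (fun i _ => h.1.mono (subset_saturate _ _)) (fun i _ => saturate_saturate _ _) hL
    exact Literal.sat_congr (V := layer rk (rk L.pred)) rfl this this
  refine ⟨h.1.mono (subset_saturate _ _), ⟨?_, ?_⟩, ?_⟩
  · exact fun a ha hal => DescriptionLogic.models_of_saturate hal (h.2.1.1 a ha)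
  · intro r hr hri hbZ hbi
    refine (Literal.sat_congr hri (hss i) (hss i)).2 (h.2.1.2 r hr fun L hL => ?_)
    rcases lt_or_eq_of_le (hri ▸ hK.program r hr L hL) with hlt | heq
    · exact (hlow L hlt).1 (hbZ L hL hlt hZne)
    · exact (Literal.sat_congr (V := layer rk i) heq (hss i) (hss i)).1 (hbi L hL heq)
  · intro Y hXY hY
    -- replace the projection of `M` to layer `i` by that of `Y`
    let X : ι → Set (Interp S) := fun j => saturate (layer rk j) (if j = i then Y else M)
    have hMY : M ⊆ Y := (subset_saturate _ M).trans hXY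
    have hXi : X i = saturate (layer rk i) Y := by simp [X]
    have hXj : ∀ j, j ≠ i → X j = saturate (layer rk j) M := fun j hj => by simp [X, hj]
    have hMX : ∀ j, M ⊆ X j := by
      intro j
      by_cases hj : j = i
      · subst hj
        rw [hXi]
        exact hMY.trans (subset_saturate _ _)
      · rw [hXj j hj]
        exact subset_saturate _ _
    have e : ∀ j, m j → saturate (layer rk j) (⋂ i, ⋂ (_ : m i), X i) = X j := fun j hj =>
      saturate_iInter rk m X (fun j _ => h.1.mono (hMX j)) (fun j _ => saturate_saturate _ _) hj
    have hsub : M ⊆ ⋂ i, ⋂ (_ : m i), X i := Set.subset_iInter₂ fun j _ => hMX j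
    -- The modified product satisfies `K` relative to `M`: on layer `i` because `Y` does, and
    -- elsewhere because the heads see the same projection as in `M` while true bodies stay true in
    -- the smaller set `M`.
    have hle : (⋂ i, ⋂ (_ : m i), X i) ⊆ M := by
      refine h.2.2 _ hsub ⟨?_, ?_⟩
      · intro a ha J hJ
        obtain ⟨P, hP⟩ := hK.ontology a ha
        have hJP := Set.mem_iInter₂.1 hJ _ (hm P)
        by_cases hPi : rk P = i
        · rw [hPi] at hP hJP
          rw [hXi] at hJP
          exact DescriptionLogic.models_of_saturate hP (hY.1 a ha hP) J hJP
        · rw [hXj _ hPi] at hJP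
          exact DescriptionLogic.models_of_saturate hP (h.2.1.1 a ha) J hJP
      · intro r hr hb
        by_cases hri : rk r.head.pred = i
        · have eM := (e i hi).trans hXi
          refine (Literal.sat_congr (V := layer rk i) hri eM (hss i).symm).2
            (hY.2 r hr hri ?_ ?_)
          · exact fun L hL hLi _ => (hlow L hLi).2 ((hb L hL).anti hsub)
          · exact fun L hL hLi =>
              (Literal.sat_congr (V := layer rk i) hLi eM (hss i).symm).1 (hb L hL)
        · exact (Literal.sat_congr (V := layer rk (rk r.head.pred)) rfl
            ((e _ (hm _)).trans (hXj _ hri)) rfl).2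
            (h.2.1.2 r hr fun L hL => (hb L hL).anti hsub)
    calc Y ⊆ saturate (layer rk i) Y := subset_saturate _ _
      _ = saturate (layer rk i) (⋂ i, ⋂ (_ : m i), X i) := by rw [e i hi, hXi]
      _ ⊆ saturate (layer rk i) M := saturate_mono _ hle

end Layers

/-! ### From splitting sequences to layers -/

section SplittingSequence

variable {S : Signature.{u, v}} {D : DescriptionLogic.{u, v, w} S} {K : HybridKB D}
  {μ : Ordinal.{x}} {U : Ordinal.{x} → Set S.Pred}

/-- The first index at which a predicate symbol appears in a sequence. -/
noncomputable def rank (μ : Ordinal.{x}) (U : Ordinal.{x} → Set S.Pred) (P : S.Pred) :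
    Ordinal.{x} :=
  sInf {α | α < μ ∧ P ∈ U α}

theorem HybridKB.IsSplittingSequence.rank_mem (hU : K.IsSplittingSequence μ U) (P : S.Pred) :
    rank μ U P < μ ∧ P ∈ U (rank μ U P) := by
  have hP : P ∈ ⋃ α < μ, U α := hU.cover ▸ Set.mem_univ P
  obtain ⟨α, hα, hP⟩ := Set.mem_iUnion₂.1 hP
  exact csInf_mem (s := {α | α < μ ∧ P ∈ U α}) ⟨α, hα, hP⟩

theorem HybridKB.IsSplittingSequence.mem_iff (hU : K.IsSplittingSequence μ U) {α : Ordinal.{x}}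
    (hα : α < μ) (P : S.Pred) : P ∈ U α ↔ rank μ U P ≤ α :=
  ⟨fun h => csInf_le' ⟨hα, h⟩, fun h => hU.monotone _ _ h hα (hU.rank_mem P).2⟩

theorem HybridKB.IsSplittingSequence.not_isSuccLimit_rank (hU : K.IsSplittingSequence μ U)
    (P : S.Pred) : ¬ Order.IsSuccLimit (rank μ U P) := by
  intro hl
  obtain ⟨hμ, hP⟩ := hU.rank_mem P
  rw [hU.continuous _ hμ hl] at hP
  obtain ⟨η, hη, hP⟩ := Set.mem_iUnion₂.1 hP
  exact absurd ((hU.mem_iff (hη.trans hμ) P).1 hP) (not_le.2 hη)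

/-- Apply the splitting property at the rank of a symbol of the axiom, or of the head: all other
symbols then have at most that rank. For axioms the argument is symmetric, giving equality. -/
theorem HybridKB.IsSplittingSequence.isStratified (hU : K.IsSplittingSequence μ U) :
    K.IsStratified (rank μ U) := by
  constructor
  · intro a ha
    have hle : ∀ P ∈ D.preds a, ∀ Q ∈ D.preds a, rank μ U P ≤ rank μ U Q := by
      intro P hP Q hQ
      obtain ⟨hμ, hQU⟩ := hU.rank_mem Q
      exact (hU.mem_iff hμ P).1 ((hU.splitting _ hμ).1 a ha ⟨Q, hQ, hQU⟩ hP)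
    obtain ⟨P, hP⟩ := (D.toFO a).preds_nonempty
    exact ⟨P, fun Q hQ => le_antisymm (hle Q hQ P hP) (hle P hP Q hQ)⟩
  · intro r hr L hL
    obtain ⟨hμ, hH⟩ := hU.rank_mem r.head.pred
    refine (hU.mem_iff hμ _).1 ((hU.splitting _ hμ).2 r hr ⟨_, ?_, hH⟩ (Or.inr ?_))
    · rw [Literal.preds_eq]; rfl
    · exact Set.mem_iUnion₂.2 ⟨L, hL, by rw [Literal.preds_eq]; rfl⟩

theorem HybridKB.IsSplittingSequence.rule_preds_subset_iff (hU : K.IsSplittingSequence μ U)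
    {α : Ordinal.{x}} (hα : α < μ) {r : Rule S} (hr : r ∈ K.program) :
    r.preds ⊆ U α ↔ rank μ U r.head.pred ≤ α := by
  have hh : r.head.pred ∈ r.head.preds := by rw [Literal.preds_eq]; rfl
  rw [← hU.mem_iff hα]
  exact ⟨fun h => h (Or.inl hh), fun h => (hU.splitting _ hα).2 r hr ⟨_, hh, h⟩⟩

/-- No rank lies below `0`, so `Z` is never consulted. -/
theorem HybridKB.IsSplittingSequence.sat_bottom_zero (hU : K.IsSplittingSequence μ U)
    (hμ : 0 < μ) (Z M N : Set (Interp S)) :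
    (K.bottom (U 0)).Sat M N ↔ K.LayerSat (rank μ U) 0 Z M N := by
  have hlay : layer (rank μ U) 0 = U 0 := by
    ext P
    rw [hU.mem_iff hμ, nonpos_iff_eq_zero]
    rfl
  unfold HybridKB.Sat HybridKB.LayerSat HybridKB.bottom
  rw [hlay]
  refine and_congr ⟨fun h a ha hl => h a ⟨ha, hl⟩, fun h a ha => h a ha.1 ha.2⟩ ?_
  constructor
  · intro h r hr hri _ hb
    refine h r ⟨hr, (hU.rule_preds_subset_iff hμ hr).2 hri.le⟩ fun L hL => hb L hL ?_
    exact nonpos_iff_eq_zero.1 (hri ▸ hU.isStratified.program r hr L hL)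
  · intro h r hr hb
    exact h r hr.1 (nonpos_iff_eq_zero.1 ((hU.rule_preds_subset_iff hμ hr.1).1 hr.2))
      (fun L _ hL => absurd hL not_lt_zero) (fun L hL _ => hb L hL)

theorem HybridKB.IsSplittingSequence.sat_reduct (hU : K.IsSplittingSequence μ U)
    {α : Ordinal.{x}} (hα : α + 1 < μ) (Z M N : Set (Interp S)) :
    ((K.bottom (U (α + 1))).reduct (U α) Z).Sat M N ↔
      K.LayerSat (rank μ U) (α + 1) Z M N := by
  classical
  have hα' : α < μ := (Order.lt_add_one_iff.2 le_rfl).trans hα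
  -- Lying in the bottom for `U (α + 1)` but not in that for `U α` amounts to having rank exactly `α
  -- + 1`.
  have heq : ∀ β : Ordinal.{x}, β = α + 1 ↔ β ≤ α + 1 ∧ ¬ β ≤ α := fun β =>
    ⟨fun h => ⟨h.le, h ▸ not_le.2 (Order.lt_add_one_iff.2 le_rfl)⟩,
      fun h => le_antisymm h.1 (Order.add_one_le_iff.2 (not_le.1 h.2))⟩
  have htop : ∀ r, r ∈ ((K.bottom (U (α + 1))).top (U α)).program ↔
      r ∈ K.program ∧ rank μ U r.head.pred = α + 1 := by
    intro r
    constructor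
    · rintro ⟨⟨hr, h₁⟩, h₂⟩
      refine ⟨hr, (heq _).2 ⟨(hU.rule_preds_subset_iff hα hr).1 h₁, fun h => h₂ ?_⟩⟩
      exact ⟨⟨hr, h₁⟩, (hU.rule_preds_subset_iff hα' hr).2 h⟩
    · rintro ⟨hr, h⟩
      refine ⟨⟨hr, (hU.rule_preds_subset_iff hα hr).2 h.le⟩, fun h₂ => ?_⟩
      exact ((heq _).1 h).2 ((hU.rule_preds_subset_iff hα' hr).1 h₂.2)
  have hlow : ∀ L : Literal S, L.preds ⊆ U α ↔ rank μ U L.pred < α + 1 := by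
    intro L
    rw [L.preds_eq, Set.singleton_subset_iff, hU.mem_iff hα', Order.lt_add_one_iff]
  have hhigh : ∀ L : Literal S, L.preds ⊆ (U α)ᶜ ↔ ¬ rank μ U L.pred < α + 1 := by
    intro L
    rw [L.preds_eq, Set.singleton_subset_iff, Set.mem_compl_iff, hU.mem_iff hα',
      Order.lt_add_one_iff]
  -- An empty `Z` entails everything, even a `not`-literal that fails in it; this is the reason for
  -- the guard `Z.Nonempty` in `LayerSat`.
  have hent : ∀ r : Rule S,
      Entails Z (Literal.toMKNF '' {L | L ∈ r.body ∧ L.preds ⊆ U α}) ↔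
        ∀ L ∈ r.body, rank μ U L.pred < α + 1 → Z.Nonempty → L.Sat Z Z := by
    intro r
    constructor
    · rintro h L hL hlt ⟨I, hI⟩
      exact (L.holds_toMKNF I Z Z).1 (h _ ⟨L, ⟨hL, (hlow L).2 hlt⟩, rfl⟩ I hI)
    · rintro h _ ⟨L, ⟨hL, hlt⟩, rfl⟩ I hI
      exact (L.holds_toMKNF I Z Z).2 (h L hL ((hlow L).1 hlt) ⟨I, hI⟩)
  refine and_congr ?_ ?_
  · constructor
    · intro h a ha hal
      refine h a ⟨⟨ha, fun P hP => (hU.mem_iff hα P).2 (hal hP).le⟩, fun h₂ => ?_⟩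
      obtain ⟨P, hP⟩ := (D.toFO a).preds_nonempty
      exact ((heq _).1 (hal hP)).2 ((hU.mem_iff hα' P).1 (h₂.2 hP))
    · rintro h a ⟨⟨ha, h₁⟩, h₂⟩
      refine h a ha fun P hP => (heq _).2 ⟨(hU.mem_iff hα P).1 (h₁ hP), fun hPα => h₂ ?_⟩
      exact ⟨⟨ha, h₁⟩,
        (hU.splitting _ hα').1 a ha ⟨P, hP, (hU.mem_iff hα' P).2 hPα⟩⟩
  · constructor
    · intro h r hr hri hbZ hbi
      refine h ⟨r.head, r.body.filter fun L => L.preds ⊆ (U α)ᶜ⟩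
        ⟨r, (htop r).2 ⟨hr, hri⟩, (hent r).2 hbZ, rfl, ?_⟩ fun L hL => ?_
      · ext L
        simp
      · obtain ⟨hL, hLU⟩ := Finset.mem_filter.1 hL
        exact hbi L hL (le_antisymm (hri ▸ hU.isStratified.program r hr L hL)
          (not_lt.1 ((hhigh L).1 hLU)))
    · rintro h r' ⟨r, hr, hZ, hhead, hbody⟩ hb
      obtain ⟨hr, hri⟩ := (htop r).1 hr
      rw [hhead]
      refine h r hr hri ((hent r).1 hZ) fun L hL hLi => hb L ?_
      have hL' : L ∈ {L | L ∈ r.body ∧ L.preds ⊆ (U α)ᶜ} :=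
        ⟨hL, (hhigh L).2 (not_lt.2 hLi.ge)⟩
      rwa [← hbody] at hL'

/-- By continuity no symbol first appears at a limit, so that layer imposes no condition. -/
theorem HybridKB.IsSplittingSequence.isStable_limit_iff (hU : K.IsSplittingSequence μ U)
    {α : Ordinal.{x}} (hα : Order.IsSuccLimit α) (Z X : Set (Interp S)) :
    IsStable (K.LayerSat (rank μ U) α Z) X ↔ X = Set.univ := by
  have htriv : ∀ M N, K.LayerSat (rank μ U) α Z M N := by
    refine fun M N => ⟨fun a _ hal => ?_, fun r _ hri => ?_⟩
    · obtain ⟨P, hP⟩ := (D.toFO a).preds_nonempty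
      have hPα : rank μ U P = α := hal hP
      exact (hU.not_isSuccLimit_rank P (hPα ▸ hα)).elim
    · exact (hU.not_isSuccLimit_rank _ (hri ▸ hα)).elim
  constructor
  · exact fun h => Set.univ_subset_iff.1 (h.2.2 _ (Set.subset_univ _) (htriv _ _))
  · rintro rfl
    exact ⟨Set.univ_nonempty, htriv _ _, fun _ _ _ => Set.subset_univ _⟩

theorem HybridKB.IsSplittingSequence.isSolution_iff (hU : K.IsSplittingSequence μ U)
    (X : Ordinal.{x} → Set (Interp S)) :
    K.IsSolution μ U X ↔ K.IsLayerSolution (rank μ U) (· < μ) X := by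
  have hzero : ∀ (_ : 0 < μ) Z, (K.bottom (U 0)).IsModel (X 0) ↔
      IsStable (K.LayerSat (rank μ U) 0 Z) (X 0) := by
    intro hμ Z
    rw [HybridKB.isModel_iff]
    simp only [IsStable, hU.sat_bottom_zero hμ Z]
  have hsucc : ∀ α (_ : α + 1 < μ),
      ((K.bottom (U (α + 1))).reduct (U α) (⋂ η ≤ α, X η)).IsModel (X (α + 1)) ↔
        IsStable (K.LayerSat (rank μ U) (α + 1) (⋂ η < α + 1, X η)) (X (α + 1)) := by
    intro α hα
    rw [HybridKB.isModel_iff]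
    simp only [IsStable, hU.sat_reduct hα, Order.lt_add_one_iff]
  constructor
  · intro h α hα
    rcases Ordinal.zero_or_succ_or_isSuccLimit α with rfl | ⟨β, rfl⟩ | hl
    · exact (hzero hα _).1 (h.zero hα)
    · exact (hsucc β hα).1 (h.succ β hα)
    · exact (hU.isStable_limit_iff hl _ _).2 (h.limit α hα hl)
  · intro h
    exact ⟨fun α hα => (h α hα).1, fun hμ => (hzero hμ _).2 (h 0 hμ),
      fun α hα => (hsucc α hα).2 (h _ hα),
      fun α hα hl => (hU.isStable_limit_iff hl _ _).1 (h α hα)⟩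

end SplittingSequence

end MKNF

theorem theorem2 {S : MKNF.Signature} {D : MKNF.DescriptionLogic S} (K : MKNF.HybridKB D)
    (μ : Ordinal) (U : Ordinal → Set S.Pred) (hU : K.IsSplittingSequence μ U)
    (M : Set (MKNF.Interp S)) :
    K.IsModel M ↔
      ∃ X : Ordinal → Set (MKNF.Interp S), K.IsSolution μ U X ∧ M = ⋂ α < μ, X α := by

  have hm : ∀ P, MKNF.rank μ U P < μ := fun P => (hU.rank_mem P).1
  rw [MKNF.HybridKB.isModel_iff]
  constructor
  · intro h
    exact ⟨_, (hU.isSolution_iff _).2 (MKNF.HybridKB.isLayerSolution_saturate hU.isStratified hm h),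
      (MKNF.HybridKB.iInter_saturate_eq hU.isStratified hm h).symm⟩
  · rintro ⟨X, hX, rfl⟩
    exact ((hU.isSolution_iff X).1 hX).isStable hU.isStratified hm
      fun i j hji hi => lt_trans hji hi
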